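/- Let $q$ be a prime power, let $G=\mathrm{PGL}_2(\mathbb F_q)$ act on $\overline{\mathbb F}_q\cup\{\infty\}$ by linear fractional transformations, and for $\gamma=\begin{pmatrix}a&b\\c&d\end{pmatrix}\in G$ put $\iota(\gamma)=\dfrac{(a+d)^2}{ad-bc}\in\mathbb F_q$. A quotient map for a subgroup $H\le G$ is a rational function $Q\in\mathbb F_q(x)$ such that $Q\circ\gamma=Q$ for all $\gamma\in H$ and, in lowest terms, $Q=f/g$ with $|H|=\deg f>\deg g$. An element $\tau\in\mathbb F_q$ is called $Q$-regular if $Q^{-1}(\tau)\subset\overline{\mathbb F}_q\cup\{\infty\}$ has exactly $|H|$ elements. In that case, for every $v$ with $Q(v)=\tau$ there is a unique $\gamma\in H$ with $v^q=\gamma(v)$, and its $H$-conjugacy class $\mathcal C_{\gamma,H}=\{\delta\gamma\delta^{-1}:\delta\in H\}$ does not depend on $v$; it is denoted $\mathrm{inv}_Q(\tau)$. Theorem. Let $H\le G$ be a subgroup, let $Q_H$ be a quotient map for $H$, let $$Q_G(x)=\frac{(x^{q^2}-x)^{q+1}}{(x^q-x)^{q^2+1}}=1+\frac{x^{q^3}-x}{(x^q-x)^{q^2-q+1}},$$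 which is a quotient map for $G$, and let $h\in\mathbb F_q(x)$ be the unique rational function with $Q_G=h\circ Q_H$. Let $\tau\in\mathbb F_q$ be $Q_H$-regular with $\mathrm{inv}_{Q_H}(\tau)=\mathcal C_{\gamma,H}$, where $\gamma\in H$. Then $h(\tau)=\infty$ if $\gamma=1$, and $h(\tau)=\iota(\gamma)$ if $\gamma\neq1$. -/

import Mathlib

open scoped MatrixGroups OnePoint

noncomputable section

namespace ArtinInvariant

variable {K : Type*} [Field K]

open Classical in
/-- The action of `PGL(2, K)` on `L ∪ {∞}` by linear fractional transformations,
`[a, b; c, d] (v) = (a v + b) / (c v + d)`, for a field extension `L` of `K`. -/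
def moebius {L : Type*} [Field L] [Algebra K L] (γ : PGL(2, K)) (v : OnePoint L) : OnePoint L :=
  Quotient.lift (s := QuotientGroup.leftRel (Subgroup.center (GL (Fin 2) K)))
    (fun g : GL (Fin 2) K => g.map (algebraMap K L) • v)
    (fun g₁ g₂ hg => by
      obtain ⟨u, rfl⟩ := Matrix.ProjGenLinGroup.mk_eq_mk_iff.mp (Quotient.sound hg)
      have hu : algebraMap K L (u : K) ≠ 0 := by simp
      cases v with
      | infty =>
        simp [OnePoint.smul_infty_eq_ite, Matrix.mul_apply, Fin.sum_univ_two,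
          mul_div_mul_right _ _ hu]
      | coe v =>
        have h0 : ∀ a b : L, a * algebraMap K L u * v + b * algebraMap K L u
            = (a * v + b) * algebraMap K L u := fun a b => by ring
        simp [OnePoint.smul_some_eq_ite, Matrix.mul_apply, Fin.sum_univ_two, h0,
          mul_div_mul_right _ _ hu])
    γ

open Classical in
theorem moebius_mk {L : Type*} [Field L] [Algebra K L] (g : GL (Fin 2) K) (v : OnePoint L) :
    moebius (Matrix.ProjGenLinGroup.mk g) v = g.map (algebraMap K L) • v := rfl

/-- `ι(γ) = (a + d)² / (a d - b c)` for the class `γ ∈ PGL(2, K)` of `[a, b; c, d]`. -/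
def iota (γ : PGL(2, K)) : K :=
  Quotient.lift (s := QuotientGroup.leftRel (Subgroup.center (GL (Fin 2) K)))
    (fun g : GL (Fin 2) K => (g 0 0 + g 1 1) ^ 2 / (g 0 0 * g 1 1 - g 0 1 * g 1 0))
    (fun g₁ g₂ hg => by
      obtain ⟨u, rfl⟩ := Matrix.ProjGenLinGroup.mk_eq_mk_iff.mp (Quotient.sound hg)
      have hu : ((u : K) ^ 2) ≠ 0 := by simp
      simp only [Units.val_mul, Matrix.mul_apply, Fin.sum_univ_two]
      simp only [Matrix.GeneralLinearGroup.coe_scalar, Matrix.scalar_apply, Matrix.diagonal_apply]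
      simp only [Fin.isValue, ↓reduceIte, zero_ne_one, one_ne_zero, mul_zero, add_zero, zero_add]
      rw [← mul_div_mul_right _ _ hu]
      congr 1 <;> ring)
    γ

theorem iota_mk (g : GL (Fin 2) K) :
    iota (Matrix.ProjGenLinGroup.mk g)
      = (g 0 0 + g 1 1) ^ 2 / (g 0 0 * g 1 1 - g 0 1 * g 1 0) := rfl

open Classical in
/-- The map `L ∪ {∞} → L ∪ {∞}` induced by a rational function `Q ∈ K(x)`, written in lowest terms
as `f / g`. At a point of `L` the value is `f(v) / g(v)`, or `∞` if `g(v) = 0`. At `∞` the value is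
`∞` if `deg f > deg g`, and otherwise the quotient of the coefficients of `x ^ (deg g)`. -/
def value {L : Type*} [Field L] [Algebra K L] (Q : RatFunc K) : OnePoint L → OnePoint L
  | some v => if Polynomial.aeval v Q.denom = 0 then ∞
      else ((Polynomial.aeval v Q.num / Polynomial.aeval v Q.denom : L) : OnePoint L)
  | ∞ => if Q.denom.natDegree < Q.num.natDegree then ∞
      else ((algebraMap K L (Q.num.coeff Q.denom.natDegree / Q.denom.leadingCoeff) : L) :
        OnePoint L)

/-- The composition `f ∘ g = f(g(x))` of rational functions (meaningful for nonconstant `g`). -/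
def comp (f g : RatFunc K) : RatFunc K := f.eval RatFunc.C g

/-- The linear fractional transformation `(a x + b) / (c x + d)` as a rational function. -/
def moebiusFunc (g : GL (Fin 2) K) : RatFunc K :=
  (RatFunc.C (g 0 0) * RatFunc.X + RatFunc.C (g 0 1)) /
    (RatFunc.C (g 1 0) * RatFunc.X + RatFunc.C (g 1 1))

/-- `Q ∈ K(x)` is a quotient map for the finite subgroup `H` of `PGL(2, K)`: it is `H`-invariant,
and in lowest terms `Q = f / g` with `|H| = deg f > deg g`. -/
structure IsQuotientMap (H : Subgroup PGL(2, K)) (Q : RatFunc K) : Prop where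
  invariant : ∀ g : GL (Fin 2) K, Matrix.ProjGenLinGroup.mk g ∈ H → comp Q (moebiusFunc g) = Q
  natDegree_num : Q.num.natDegree = Nat.card H
  natDegree_denom_lt : Q.denom.natDegree < Q.num.natDegree

/-- `τ` is regular with respect to the quotient map `Q` for `H`: the fibre `Q⁻¹(τ)` in
`K̄ ∪ {∞}` has exactly `|H|` elements. -/
def IsRegular (H : Subgroup PGL(2, K)) (Q : RatFunc K) (τ : OnePoint (AlgebraicClosure K)) : Prop :=
  {v : OnePoint (AlgebraicClosure K) | value Q v = τ}.ncard = Nat.card H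

/-- The defining property of the Artin invariant: whenever `Q(v) = τ`, one has `σ(v) = γ(v)` for
some `γ ∈ H` whose `H`-conjugacy class is `C`. -/
def IsArtinInv (H : Subgroup PGL(2, K)) (Q : RatFunc K)
    (σ : AlgebraicClosure K ≃ₐ[K] AlgebraicClosure K) (τ : AlgebraicClosure K)
    (C : ConjClasses H) : Prop :=
  ∀ v : AlgebraicClosure K, value Q (v : OnePoint (AlgebraicClosure K)) = τ →
    ∃ γ : H, ((σ v : AlgebraicClosure K) : OnePoint (AlgebraicClosure K))
      = moebius (γ : PGL(2, K)) (v : OnePoint (AlgebraicClosure K)) ∧ ConjClasses.mk γ = C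

open Classical in
/-- The Artin invariant `inv_Q(τ, σ)`, a conjugacy class of `H`. It is the class characterized by
`IsArtinInv`, which exists and is unique when `Q` is a quotient map for `H`, `σ(τ) = τ` and `τ` is
regular; in the other cases the value is of no significance. -/
def artinInv (H : Subgroup PGL(2, K)) (Q : RatFunc K)
    (σ : AlgebraicClosure K ≃ₐ[K] AlgebraicClosure K) (τ : AlgebraicClosure K) : ConjClasses H :=
  if h : ∃ C : ConjClasses H, IsArtinInv H Q σ τ C then h.choose else ConjClasses.mk 1

/-- For `K = 𝔽_q`, the invariant `inv_Q(τ, q)` of `τ ∈ 𝔽_q` with respect to `v ↦ v ^ q`. -/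
def artinInvFrob {F : Type*} [Field F] [Fintype F] (H : Subgroup PGL(2, F)) (Q : RatFunc F)
    (τ : F) : ConjClasses H :=
  artinInv H Q (FiniteField.frobeniusAlgEquivOfAlgebraic F (AlgebraicClosure F))
    (algebraMap F (AlgebraicClosure F) τ)

/-- The quotient map `Q_G(x) = (x^(q²) - x)^(q+1) / (x^q - x)^(q²+1)` for `G = PGL(2, 𝔽_q)`. -/
def quotientMapPGL (F : Type*) [Field F] [Fintype F] : RatFunc F :=
  (RatFunc.X ^ (Fintype.card F ^ 2) - RatFunc.X) ^ (Fintype.card F + 1) /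
    (RatFunc.X ^ Fintype.card F - RatFunc.X) ^ (Fintype.card F ^ 2 + 1)

end ArtinInvariant

end

/-! Choose a finite `v` with `Q_H(v) = τ`. Frobenius fixes `τ`, and `H` acts simply transitively on
the fibre, so `v^q = δ(v)` with `δ` conjugate to `γ`. Everything reduces to evaluating `Q_G = h ∘
Q_H` at `v`.

If `δ ≠ 1`, then `v` is not rational. Additivity of Frobenius turns `Q_G(v)` into a cross ratio of
`v, δv, δ²v, δ³v`, which equals trace² / det (`cross_ratio`, `aeval_pglNum`). If `δ = 1`, then `v`
is rational; the numerator of `Q_G` vanishes there to order `q + 1`, the denominator to order `q² +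
1`, so there is a pole (`eval_eq_zero_of_mul_pow_eq`).

Transitivity comes from factoring the fibre over the generic point (`generic_fibre`) and
specialising; freeness then follows by counting a regular fibre. -/

namespace ArtinInvariant

open Polynomial Matrix.ProjGenLinGroup

/-! ### Möbius action, `ι`, and values of rational functions -/

section Action

variable {K L : Type*} [Field K] [Field L] [Algebra K L]

theorem moebius_one (v : OnePoint L) : moebius (1 : PGL(2, K)) v = v := by
  classical
  rw [← mk_one, moebius_mk, map_one]
  exact one_smul _ v

theorem moebius_mul (γ δ : PGL(2, K)) (v : OnePoint L) :
    moebius (γ * δ) v = moebius γ (moebius δ v) := by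
  obtain ⟨g, rfl⟩ := mk_surjective γ
  obtain ⟨h, rfl⟩ := mk_surjective δ
  classical
  rw [← map_mul, moebius_mk, moebius_mk, moebius_mk, map_mul]
  exact mul_smul _ _ v

/-- An element of `L ∪ {∞}` in homogeneous coordinates: `(a v + b) / (c v + d) = w`. -/
theorem moebius_mk_eq_coe_iff (g : GL (Fin 2) K) (v w : L) :
    moebius (mk g) (v : OnePoint L) = (w : OnePoint L) ↔
      algebraMap K L (g 1 0) * v + algebraMap K L (g 1 1) ≠ 0 ∧
        algebraMap K L (g 0 0) * v + algebraMap K L (g 0 1)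
          = w * (algebraMap K L (g 1 0) * v + algebraMap K L (g 1 1)) := by
  classical
  rw [moebius_mk, OnePoint.smul_some_eq_ite]
  simp only [Matrix.GeneralLinearGroup.map_apply]
  split_ifs with h
  · simp [h, OnePoint.infty_ne_coe]
  · rw [OnePoint.coe_eq_coe, div_eq_iff h]
    simp [h]

theorem mk_eq_one_of_entries {g : GL (Fin 2) K} (h₁ : g 1 0 = 0) (h₂ : g 0 1 = 0)
    (h₃ : g 0 0 = g 1 1) : mk g = 1 := by
  have hd : (g 0 0) ≠ 0 := by
    intro h0
    apply g.det_ne_zero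
    rw [Matrix.det_fin_two, h0, h₁]
    ring
  rw [← mk_scalar (Units.mk0 (g 0 0) hd)]
  congr 1
  ext i j
  fin_cases i <;> fin_cases j <;>
    simp [Matrix.GeneralLinearGroup.coe_scalar, h₁, h₂, h₃]

/-- A nontrivial Möbius transformation over `K` has no transcendental fixed point. -/
theorem eq_one_of_moebius_transcendental {x : L} (hx : Transcendental K x) {γ : PGL(2, K)}
    (h : moebius γ (x : OnePoint L) = (x : OnePoint L)) : γ = 1 := by
  obtain ⟨g, rfl⟩ := mk_surjective γ
  rw [moebius_mk_eq_coe_iff] at h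
  have hp : (C (g 1 0) * X ^ 2 + C (g 1 1 - g 0 0) * X + C (-g 0 1) : K[X]) = 0 := by
    refine transcendental_iff.mp hx _ ?_
    simp only [map_add, map_mul, aeval_C, map_pow, aeval_X, map_sub, map_neg]
    linear_combination -h.2
  have h2 := congrArg (coeff · 2) hp
  have h1 := congrArg (coeff · 1) hp
  have h0 := congrArg (coeff · 0) hp
  simp [coeff_X, coeff_C] at h2 h1 h0
  exact mk_eq_one_of_entries h2 h0 (sub_eq_zero.mp h1).symm

theorem moebius_algHom (σ : L →ₐ[K] L) (γ : PGL(2, K)) {v w : L}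
    (h : moebius γ (v : OnePoint L) = (w : OnePoint L)) :
    moebius γ (σ v : OnePoint L) = (σ w : OnePoint L) := by
  obtain ⟨g, rfl⟩ := mk_surjective γ
  rw [moebius_mk_eq_coe_iff] at h ⊢
  refine ⟨?_, by simpa using congrArg σ h.2⟩
  have := (map_ne_zero σ).mpr h.1
  simpa using this

theorem iota_conj (γ δ : PGL(2, K)) : iota (δ * γ * δ⁻¹) = iota γ := by
  obtain ⟨g, rfl⟩ := mk_surjective γ
  obtain ⟨h, rfl⟩ := mk_surjective δ
  rw [← map_mul, ← map_inv, ← map_mul, iota_mk, iota_mk]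
  rw [← Matrix.det_fin_two, ← Matrix.det_fin_two, ← Matrix.trace_fin_two, ← Matrix.trace_fin_two,
    Matrix.GeneralLinearGroup.coe_mul, Matrix.GeneralLinearGroup.coe_mul,
    Matrix.trace_units_conj, Matrix.det_units_conj]

theorem value_eq_coe_iff (Q : RatFunc K) (v t : L) :
    value Q (v : OnePoint L) = (t : OnePoint L) ↔
      aeval v Q.denom ≠ 0 ∧ aeval v Q.num = t * aeval v Q.denom := by
  classical
  have : value Q (v : OnePoint L) = if aeval v Q.denom = 0 then ∞
      else ((aeval v Q.num / aeval v Q.denom : L) : OnePoint L) := rfl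
  rw [this]
  split_ifs with h
  · simp [h, OnePoint.infty_ne_coe]
  · rw [OnePoint.coe_eq_coe, div_eq_iff h]
    simp [h]

theorem value_eq_infty (Q : RatFunc K) {v : L} (hv : aeval v Q.denom = 0) :
    value Q (v : OnePoint L) = ∞ := if_pos hv

end Action

/-! ### Factorisation of the fibres of a quotient map -/

section Fibre

variable {K : Type*} [Field K]

/-- A matrix representing an element of `PGL(2, K)`. -/
noncomputable def rep (γ : PGL(2, K)) : GL (Fin 2) K := (mk_surjective γ).choose

@[simp] theorem mk_rep (γ : PGL(2, K)) : mk (rep γ) = γ := (mk_surjective γ).choose_spec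

/-- The numerator `a x + b` of the Möbius transformation `γ`. -/
noncomputable def repNum (γ : PGL(2, K)) : K[X] := C (rep γ 0 0) * X + C (rep γ 0 1)

/-- The denominator `c x + d` of the Möbius transformation `γ`. -/
noncomputable def repDenom (γ : PGL(2, K)) : K[X] := C (rep γ 1 0) * X + C (rep γ 1 1)

theorem repDenom_ne_zero (γ : PGL(2, K)) : repDenom γ ≠ 0 := by
  intro h
  have h1 := congrArg (coeff · 1) h
  have h0 := congrArg (coeff · 0) h
  simp [repDenom, coeff_C] at h1 h0
  apply (rep γ).det_ne_zero
  rw [Matrix.det_fin_two, h0, h1]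
  ring

theorem moebiusFunc_rep (γ : PGL(2, K)) : moebiusFunc (rep γ) =
    algebraMap K[X] (RatFunc K) (repNum γ) / algebraMap K[X] (RatFunc K) (repDenom γ) := by
  simp [moebiusFunc, repNum, repDenom]

theorem moebius_X (γ : PGL(2, K)) : moebius γ ((RatFunc.X : RatFunc K) : OnePoint (RatFunc K))
    = (moebiusFunc (rep γ) : OnePoint (RatFunc K)) := by
  have h : algebraMap K[X] (RatFunc K) (repDenom γ) ≠ 0 := by simpa using repDenom_ne_zero γ
  have h' : algebraMap K (RatFunc K) (rep γ 1 0) * RatFunc.X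
      + algebraMap K (RatFunc K) (rep γ 1 1) = algebraMap K[X] (RatFunc K) (repDenom γ) := by
    simp [repDenom, RatFunc.algebraMap_eq_C]
  conv_lhs => rw [← mk_rep γ]
  rw [moebius_mk_eq_coe_iff, h', moebiusFunc_rep, div_mul_cancel₀ _ h]
  exact ⟨h, by simp [repNum, RatFunc.algebraMap_eq_C]⟩

/-- The generic point `x` of `K(x)` is transcendental, so its stabiliser is trivial. -/
theorem moebiusFunc_rep_injective :
    Function.Injective fun γ : PGL(2, K) => moebiusFunc (rep γ) := by
  intro γ δ h
  have h1 : moebius γ ((RatFunc.X : RatFunc K) : OnePoint (RatFunc K))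
      = moebius δ ((RatFunc.X : RatFunc K) : OnePoint (RatFunc K)) := by
    rw [moebius_X, moebius_X]; exact congrArg _ h
  have h2 : δ⁻¹ * γ = 1 := by
    apply eq_one_of_moebius_transcendental RatFunc.transcendental_X
    rw [moebius_mul, h1, ← moebius_mul, inv_mul_cancel, moebius_one]
  exact (inv_mul_eq_one.mp h2).symm

variable {H : Subgroup PGL(2, K)} {Q : RatFunc K}

theorem IsQuotientMap.ne_zero (hQ : IsQuotientMap H Q) : Q ≠ 0 := by
  rintro rfl
  simpa using hQ.natDegree_denom_lt

theorem IsQuotientMap.eval₂_num_eq (hQ : IsQuotientMap H Q) (γ : H) :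
    Q.num.eval₂ RatFunc.C (moebiusFunc (rep (γ : PGL(2, K))))
      = Q * Q.denom.eval₂ RatFunc.C (moebiusFunc (rep (γ : PGL(2, K)))) := by
  have h := hQ.invariant (rep γ) (by simp)
  rw [comp] at h
  -- A vanishing denominator would give the default value `0`, but the composite is `Q ≠ 0`.
  have h0 := RatFunc.eval₂_denom_ne_zero (h.trans_ne hQ.ne_zero)
  rwa [RatFunc.eval, div_eq_iff h0] at h

variable [Fintype H]

/-- Both sides have degree `|H|` and the same leading coefficient, and by invariance they vanish at
the `|H|` distinct points `γ(x)`. -/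
theorem IsQuotientMap.generic_fibre (hQ : IsQuotientMap H Q) :
    Q.num.map RatFunc.C - C Q * Q.denom.map RatFunc.C
      = C (RatFunc.C Q.num.leadingCoeff) *
        ∏ γ : H, (X - C (moebiusFunc (rep (γ : PGL(2, K))))) := by
  have hlt : (C Q * Q.denom.map RatFunc.C).degree < (Q.num.map RatFunc.C).degree := by
    rw [degree_C_mul hQ.ne_zero, degree_map, degree_map]
    exact degree_lt_degree hQ.natDegree_denom_lt
  have hnum : Q.num ≠ 0 := RatFunc.num_ne_zero hQ.ne_zero
  have hdeg : (Q.num.map RatFunc.C - C Q * Q.denom.map RatFunc.C).degree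
      = (Finset.univ : Finset H).card := by
    rw [degree_sub_eq_left_of_degree_lt hlt, degree_map, degree_eq_natDegree hnum,
      hQ.natDegree_num, Nat.card_eq_fintype_card, Finset.card_univ]
  refine eq_of_degree_le_of_eval_index_eq (ι := H)
    (v := fun γ => moebiusFunc (rep (γ : PGL(2, K)))) Finset.univ
    (moebiusFunc_rep_injective.comp Subtype.val_injective).injOn hdeg.le ?_ ?_ ?_
  · rw [hdeg, degree_C_mul (by simpa using hnum), degree_prod]
    simp
  · rw [leadingCoeff_sub_of_degree_lt hlt, leadingCoeff_map, leadingCoeff_mul, leadingCoeff_C,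
      (monic_prod_X_sub_C _ _).leadingCoeff, mul_one]
  · intro γ hγ
    rw [eval_mul, eval_prod, Finset.prod_eq_zero hγ (by simp), mul_zero, eval_sub, eval_mul,
      eval_C, eval_map, eval_map, hQ.eval₂_num_eq, sub_self]

/-- Clearing denominators puts the coefficients in `K[x]`, so that `x` can be specialised to any
`v`. -/
theorem IsQuotientMap.generic_fibre' (hQ : IsQuotientMap H Q) :
    C (∏ γ : H, repDenom (γ : PGL(2, K))) * (C Q.denom * Q.num.map C - C Q.num * Q.denom.map C)
      = C (C Q.num.leadingCoeff * Q.denom) *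
        ∏ γ : H, (C (repDenom (γ : PGL(2, K))) * X - C (repNum (γ : PGL(2, K)))) := by
  apply map_injective (algebraMap K[X] (RatFunc K)) (RatFunc.algebraMap_injective K)
  have hC : (algebraMap K[X] (RatFunc K)).comp C = RatFunc.C := by
    ext; simp
  have hd : algebraMap K[X] (RatFunc K) Q.denom ≠ 0 := by simpa using Q.denom_ne_zero
  have hQ' : algebraMap K[X] (RatFunc K) Q.num = Q * algebraMap K[X] (RatFunc K) Q.denom := by
    rw [← div_eq_iff hd, RatFunc.num_div_denom]
  have hfac : ∀ γ : H, C (algebraMap K[X] (RatFunc K) (repDenom (γ : PGL(2, K)))) * X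
      - C (algebraMap K[X] (RatFunc K) (repNum (γ : PGL(2, K))))
      = C (algebraMap K[X] (RatFunc K) (repDenom (γ : PGL(2, K)))) *
        (X - C (moebiusFunc (rep (γ : PGL(2, K))))) := by
    intro γ
    have h : algebraMap K[X] (RatFunc K) (repDenom (γ : PGL(2, K))) ≠ 0 := by
      simpa using repDenom_ne_zero _
    rw [moebiusFunc_rep, mul_sub, ← C_mul, mul_div_cancel₀ _ h]
  simp only [Polynomial.map_mul, Polynomial.map_sub, Polynomial.map_prod, map_C, map_X, map_map,
    hC, hfac, Finset.prod_mul_distrib, map_mul, map_prod, hQ']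
  have := hQ.generic_fibre
  rw [RatFunc.algebraMap_C]
  linear_combination (C ((algebraMap K[X] (RatFunc K)) Q.denom)
    * ∏ γ : H, C (algebraMap K[X] (RatFunc K) (repDenom (γ : PGL(2, K))))) * this

variable {L : Type*} [Field L] [Algebra K L]

theorem IsQuotientMap.fibre (hQ : IsQuotientMap H Q) (v : L) :
    C (∏ γ : H, aeval v (repDenom (γ : PGL(2, K)))) *
        (C (aeval v Q.denom) * Q.num.map (algebraMap K L)
          - C (aeval v Q.num) * Q.denom.map (algebraMap K L))
      = C (algebraMap K L Q.num.leadingCoeff * aeval v Q.denom) *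
        ∏ γ : H, (C (aeval v (repDenom (γ : PGL(2, K)))) * X
          - C (aeval v (repNum (γ : PGL(2, K))))) := by
  have h := congrArg (Polynomial.map ((aeval v : K[X] →ₐ[K] L) : K[X] →+* L)) hQ.generic_fibre'
  have hC : ((aeval v : K[X] →ₐ[K] L) : K[X] →+* L).comp C = algebraMap K L := by
    ext; simp
  simp only [Polynomial.map_mul, Polynomial.map_sub, Polynomial.map_prod, map_C, map_X, map_map,
    hC] at h
  simpa only [map_mul, map_prod, RingHom.coe_coe, aeval_C] using h

theorem repNum_repDenom_ne_zero (γ : PGL(2, K)) (v : L) (h : aeval v (repDenom γ) = 0) :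
    aeval v (repNum γ) ≠ 0 := by
  intro h'
  simp only [repNum, repDenom, map_add, map_mul, aeval_C, aeval_X] at h h'
  apply (rep γ).det_ne_zero
  apply (algebraMap K L).injective
  rw [Matrix.det_fin_two, map_sub, map_mul, map_mul, map_zero]
  by_cases hc : algebraMap K L (rep γ 1 0) = 0
  · have hd : algebraMap K L (rep γ 1 1) = 0 := by simpa [hc] using h
    rw [hc, hd]; ring
  · apply mul_left_cancel₀ hc
    linear_combination (algebraMap K L (rep γ 1 0)) * (algebraMap K L (rep γ 0 0)) * h
      - (algebraMap K L (rep γ 1 0)) ^ 2 * h'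

/-- `H` acts transitively on the finite fibres of its quotient map. -/
theorem IsQuotientMap.exists_moebius (hQ : IsQuotientMap H Q) {v w t : L}
    (hv : value Q (v : OnePoint L) = (t : OnePoint L))
    (hw : value Q (w : OnePoint L) = (t : OnePoint L)) :
    ∃ γ : H, moebius (γ : PGL(2, K)) (v : OnePoint L) = (w : OnePoint L) := by
  rw [value_eq_coe_iff] at hv hw
  have hfib := hQ.fibre v
  have hne : algebraMap K L Q.num.leadingCoeff * aeval v Q.denom ≠ 0 :=
    mul_ne_zero (by simpa using RatFunc.num_ne_zero hQ.ne_zero) hv.1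
  -- No `γ ∈ H` sends `v` to `∞`: otherwise the left side of `hfib` is zero, so some linear factor
  -- on the right is the zero polynomial, and a numerator and denominator vanish together at `v`.
  have hlin : ∀ γ : H, aeval v (repDenom (γ : PGL(2, K))) ≠ 0 := by
    intro γ hγ
    rw [Finset.prod_eq_zero (Finset.mem_univ γ) hγ, C_0, zero_mul, eq_comm, mul_eq_zero,
      Finset.prod_eq_zero_iff] at hfib
    rcases hfib with h | ⟨δ, -, h⟩
    · exact hne (C_eq_zero.mp h)
    · have h1 := congrArg (coeff · 1) h
      have h0 := congrArg (coeff · 0) h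
      simp [coeff_C] at h1 h0
      exact repNum_repDenom_ne_zero _ _ h1 h0
  have h := congrArg (eval w) hfib
  have h0 : eval w (C (aeval v Q.denom) * Q.num.map (algebraMap K L)
          - C (aeval v Q.num) * Q.denom.map (algebraMap K L)) = 0 := by
    rw [eval_sub, eval_mul, eval_mul, eval_C, eval_C, eval_map_algebraMap, eval_map_algebraMap,
      hv.2, hw.2]
    ring
  rw [eval_mul, h0, mul_zero, eval_mul, eval_C, eq_comm, mul_eq_zero, or_iff_right hne,
    eval_prod, Finset.prod_eq_zero_iff] at h
  obtain ⟨γ, -, h⟩ := h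
  refine ⟨γ, ?_⟩
  have hγ := hlin γ
  rw [← mk_rep (γ : PGL(2, K)), moebius_mk_eq_coe_iff]
  simp only [eval_sub, eval_mul, eval_C, eval_X] at h
  simp only [repNum, repDenom, map_add, map_mul, aeval_C, aeval_X] at h hγ
  exact ⟨hγ, by linear_combination -h⟩

end Fibre

/-! ### Regular values and the Artin invariant -/

section Regular

variable {K : Type*} [Field K] {H : Subgroup PGL(2, K)} {Q : RatFunc K} {τ : AlgebraicClosure K}

theorem IsQuotientMap.exists_coe_of_value (hQ : IsQuotientMap H Q)
    {v : OnePoint (AlgebraicClosure K)} (hv : value Q v = (τ : OnePoint (AlgebraicClosure K))) :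
    ∃ w : AlgebraicClosure K, v = w := by
  cases v with
  | infty =>
    have : value Q (∞ : OnePoint (AlgebraicClosure K)) = ∞ := if_pos hQ.natDegree_denom_lt
    rw [this] at hv
    exact (OnePoint.infty_ne_coe _ hv).elim
  | coe w => exact ⟨w, rfl⟩

theorem value_algEquiv {σ : AlgebraicClosure K ≃ₐ[K] AlgebraicClosure K} (hσ : σ τ = τ)
    {v : AlgebraicClosure K} (hv : value Q (v : OnePoint (AlgebraicClosure K)) = τ) :
    value Q (σ v : OnePoint (AlgebraicClosure K)) = τ := by
  rw [value_eq_coe_iff] at hv ⊢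
  have h : ∀ p : K[X], aeval (σ v) p = σ (aeval v p) := fun p => aeval_algHom_apply σ v p
  rw [h, h]
  exact ⟨(map_ne_zero σ).mpr hv.1, by rw [hv.2, map_mul, hσ]⟩

variable [Finite H]

theorem IsRegular.exists_value_eq (hQ : IsQuotientMap H Q) (hτ : IsRegular H Q τ) :
    ∃ v : AlgebraicClosure K, value Q (v : OnePoint (AlgebraicClosure K)) = τ := by
  have hne : {v : OnePoint (AlgebraicClosure K) | value Q v = τ}.Nonempty := by
    apply Set.nonempty_of_ncard_ne_zero
    rw [hτ]
    exact Nat.card_pos.ne'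
  obtain ⟨v, hv⟩ := hne
  obtain ⟨w, rfl⟩ := hQ.exists_coe_of_value hv
  exact ⟨w, hv⟩

/-- `H` acts freely on the fibre of a regular value. -/
theorem IsRegular.moebius_injective (hQ : IsQuotientMap H Q) (hτ : IsRegular H Q τ)
    {v : AlgebraicClosure K} (hv : value Q (v : OnePoint (AlgebraicClosure K)) = τ) :
    Function.Injective
      fun γ : H => moebius (γ : PGL(2, K)) (v : OnePoint (AlgebraicClosure K)) := by
  have := Fintype.ofFinite H
  set m := fun γ : H => moebius (γ : PGL(2, K)) (v : OnePoint (AlgebraicClosure K))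
  -- By transitivity the orbit covers the fibre, which has `|H|` elements by regularity; hence the
  -- orbit map is injective.
  have hsub : {w : OnePoint (AlgebraicClosure K) | value Q w = τ} ⊆ m '' Set.univ := by
    intro w hw
    obtain ⟨w, rfl⟩ := hQ.exists_coe_of_value hw
    obtain ⟨γ, hγ⟩ := hQ.exists_moebius hv hw
    exact ⟨γ, trivial, hγ⟩
  have hle := Set.ncard_le_ncard hsub (Set.toFinite _)
  rw [hτ, ← Set.ncard_univ] at hle
  rw [← Set.injOn_univ]
  exact Set.injOn_of_ncard_image_eq (le_antisymm (Set.ncard_image_le (Set.toFinite _)) hle)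
    (Set.toFinite _)

/-- Since `δ` has coefficients in `K`, it commutes with `σ`: for `w = δv`, `σw = δσv = δγδ⁻¹w`. -/
theorem IsQuotientMap.exists_isArtinInv (hQ : IsQuotientMap H Q)
    {σ : AlgebraicClosure K ≃ₐ[K] AlgebraicClosure K} (hσ : σ τ = τ)
    {v : AlgebraicClosure K} (hv : value Q (v : OnePoint (AlgebraicClosure K)) = τ) :
    ∃ C, IsArtinInv H Q σ τ C := by
  have := Fintype.ofFinite H
  obtain ⟨γ, hγ⟩ := hQ.exists_moebius hv (value_algEquiv hσ hv)
  refine ⟨ConjClasses.mk γ, fun w hw => ?_⟩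
  obtain ⟨δ, hδ⟩ := hQ.exists_moebius hv hw
  have hδσ : moebius (δ : PGL(2, K)) (σ v : OnePoint (AlgebraicClosure K)) = σ w :=
    moebius_algHom (σ : AlgebraicClosure K →ₐ[K] AlgebraicClosure K) _ hδ
  refine ⟨δ * γ * δ⁻¹, ?_, ?_⟩
  · rw [← hδσ, ← hγ, ← hδ, ← moebius_mul, ← moebius_mul]
    congr 1
    simp [mul_assoc]
  · rw [ConjClasses.mk_eq_mk_iff_isConj, isConj_comm, isConj_iff]
    exact ⟨δ, rfl⟩

theorem isArtinInv_artinInv (hQ : IsQuotientMap H Q) (hτ : IsRegular H Q τ)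
    {σ : AlgebraicClosure K ≃ₐ[K] AlgebraicClosure K} (hσ : σ τ = τ) :
    IsArtinInv H Q σ τ (artinInv H Q σ τ) := by
  obtain ⟨v, hv⟩ := hτ.exists_value_eq hQ
  have h := hQ.exists_isArtinInv hσ hv
  rw [artinInv, dif_pos h]
  exact h.choose_spec

end Regular

end ArtinInvariant

namespace ArtinInvariant

open Polynomial Matrix.ProjGenLinGroup

/-! ### Clearing denominators in a composition -/

section Homogenization

variable {K L : Type*} [Field K] [CommRing L] [Algebra K L]

/-- The homogenization `∑ pᵢ fⁱ gᴹ⁻ⁱ` of `p`, evaluated at two polynomials. -/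
noncomputable def homog (p : K[X]) (M : ℕ) (f g : K[X]) : K[X] :=
  ∑ i ∈ Finset.range (M + 1), C (p.coeff i) * f ^ i * g ^ (M - i)

theorem map_homog {p : K[X]} {M : ℕ} (hM : p.natDegree ≤ M) {f g : K[X]} (φ : K[X] →ₐ[K] L) {y : L}
    (hy : φ f = y * φ g) : φ (homog p M f g) = φ g ^ M * aeval y p := by
  rw [homog, map_sum, aeval_eq_sum_range' (Nat.lt_succ_of_le hM), Finset.mul_sum]
  refine Finset.sum_congr rfl fun i hi => ?_
  have hi : i ≤ M := Nat.lt_succ_iff.mp (Finset.mem_range.mp hi)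
  obtain ⟨k, rfl⟩ := Nat.exists_eq_add_of_le hi
  rw [map_mul, map_mul, map_pow, map_pow, hy, Nat.add_sub_cancel_left, ← algebraMap_eq,
    AlgHom.commutes, Algebra.smul_def]
  ring

end Homogenization

/-! ### The quotient map of `PGL(2, 𝔽_q)` at poles and at other points -/

section FiniteField

variable {F : Type*} [Field F] [Fintype F]

local notation "q" => Fintype.card F

theorem sub_pow_card {R : Type*} [CommRing R] [Algebra F R] (x y : R) :
    (x - y) ^ q = x ^ q - y ^ q :=
  map_sub (FiniteField.frobeniusAlgHom F R) x y

theorem sub_pow_card_sq {R : Type*} [CommRing R] [Algebra F R] (x y : R) :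
    (x - y) ^ q ^ 2 = x ^ q ^ 2 - y ^ q ^ 2 := by
  rw [sq, pow_mul, pow_mul, pow_mul, sub_pow_card, sub_pow_card]

/-- The numerator of the quotient map of `PGL(2, F)`. -/
noncomputable def pglNum (F : Type*) [Field F] [Fintype F] : F[X] :=
  (X ^ Fintype.card F ^ 2 - X) ^ (Fintype.card F + 1)

/-- The denominator of the quotient map of `PGL(2, F)`. -/
noncomputable def pglDenom (F : Type*) [Field F] [Fintype F] : F[X] :=
  (X ^ Fintype.card F - X) ^ (Fintype.card F ^ 2 + 1)

theorem pglNum_ne_zero : pglNum F ≠ 0 :=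
  pow_ne_zero _ (FiniteField.X_pow_card_pow_sub_X_ne_zero F two_ne_zero Fintype.one_lt_card)

theorem pglDenom_ne_zero : pglDenom F ≠ 0 :=
  pow_ne_zero _ (FiniteField.X_pow_card_sub_X_ne_zero F Fintype.one_lt_card)

theorem quotientMapPGL_eq : quotientMapPGL F =
    algebraMap F[X] (RatFunc F) (pglNum F) / algebraMap F[X] (RatFunc F) (pglDenom F) := by
  simp [quotientMapPGL, pglNum, pglDenom]

/-- A polynomial form of `Q_G = h ∘ Q` remains usable at rational points, where numerator and
denominator of `Q_G` both vanish. -/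
theorem pglNum_mul_homog {Q h : RatFunc F} (hh : quotientMapPGL F = comp h Q) {M : ℕ}
    (hn : h.num.natDegree ≤ M) (hd : h.denom.natDegree ≤ M) :
    pglNum F * homog h.denom M Q.num Q.denom = homog h.num M Q.num Q.denom * pglDenom F := by
  apply RatFunc.algebraMap_injective F
  have hA : algebraMap F[X] (RatFunc F) (pglNum F) ≠ 0 := by simpa using pglNum_ne_zero
  have hB : algebraMap F[X] (RatFunc F) (pglDenom F) ≠ 0 := by simpa using pglDenom_ne_zero
  rw [quotientMapPGL_eq] at hh
  have hd0 : h.denom.eval₂ RatFunc.C Q ≠ 0 :=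
    RatFunc.eval₂_denom_ne_zero (hh.symm.trans_ne (div_ne_zero hA hB))
  rw [comp, RatFunc.eval, div_eq_div_iff hB hd0] at hh
  have hQd : algebraMap F[X] (RatFunc F) Q.denom ≠ 0 := by simpa using Q.denom_ne_zero
  have hQ : IsScalarTower.toAlgHom F F[X] (RatFunc F) Q.num
      = Q * IsScalarTower.toAlgHom F F[X] (RatFunc F) Q.denom := by
    change algebraMap F[X] (RatFunc F) Q.num = Q * algebraMap F[X] (RatFunc F) Q.denom
    rw [← div_eq_iff hQd, RatFunc.num_div_denom]
  have h1 := map_homog hn (IsScalarTower.toAlgHom F F[X] (RatFunc F)) hQ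
  have h2 := map_homog hd (IsScalarTower.toAlgHom F F[X] (RatFunc F)) hQ
  change algebraMap F[X] (RatFunc F) _
    = algebraMap F[X] (RatFunc F) Q.denom ^ M * h.num.eval₂ RatFunc.C Q at h1
  change algebraMap F[X] (RatFunc F) _
    = algebraMap F[X] (RatFunc F) Q.denom ^ M * h.denom.eval₂ RatFunc.C Q at h2
  rw [map_mul, map_mul, h1, h2]
  linear_combination (algebraMap F[X] (RatFunc F) Q.denom) ^ M * hh

variable {L : Type*} [Field L] [Algebra F L]

/-- The relation `Q_G = h ∘ Q` at a point of the fibre of `Q` over `t`. -/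
theorem pglNum_mul_aeval {Q h : RatFunc F} (hh : quotientMapPGL F = comp h Q) {v t : L}
    (hv : value Q (v : OnePoint L) = (t : OnePoint L)) :
    aeval v (pglNum F) * aeval t h.denom = aeval t h.num * aeval v (pglDenom F) := by
  rw [value_eq_coe_iff] at hv
  have hmul := congrArg (aeval v)
    (pglNum_mul_homog hh (le_max_left h.num.natDegree h.denom.natDegree) (le_max_right _ _))
  rw [map_mul, map_mul, map_homog (le_max_left _ _) _ hv.2, map_homog (le_max_right _ _) _ hv.2]
    at hmul
  apply mul_left_cancel₀ (pow_ne_zero (max h.num.natDegree h.denom.natDegree) hv.1)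
  linear_combination hmul

/-- This exhibits a simple zero at `v`: the cofactor takes the value `-1` there. -/
theorem X_pow_card_sub_X_eq {v : L} (hvq : v ^ q = v) :
    (X ^ q - X : L[X]) = (X - C v) * ((X - C v) ^ (q - 1) - 1) := by
  rw [mul_sub, mul_one, mul_pow_sub_one Fintype.card_ne_zero, sub_pow_card, ← C_pow, hvq]
  ring

theorem X_pow_card_sq_sub_X_eq {v : L} (hvq : v ^ q = v) :
    (X ^ q ^ 2 - X : L[X]) = (X - C v) * ((X - C v) ^ (q ^ 2 - 1) - 1) := by
  rw [mul_sub, mul_one, mul_pow_sub_one (pow_ne_zero 2 Fintype.card_ne_zero), sub_pow_card_sq,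
    ← C_pow, sq q, pow_mul v, hvq, hvq]
  ring

omit [Field F] [Fintype F] [Algebra F L] in
-- After cancelling `(X - v)^(n+1)`, the right side still vanishes at `v` because `n² > n`, while
-- the cofactor of `D` is a power of `-1` there.
theorem eval_eq_zero_of_mul_pow_eq {v : L} {n : ℕ} (hn : 1 < n) {N D : L[X]}
    (h : ((X - C v) * ((X - C v) ^ (n ^ 2 - 1) - 1)) ^ (n + 1) * D
      = N * ((X - C v) * ((X - C v) ^ (n - 1) - 1)) ^ (n ^ 2 + 1)) : eval v D = 0 := by
  have hlt : n < n ^ 2 := lt_self_pow₀ hn one_lt_two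
  have hpos : n ^ 2 - n ≠ 0 := Nat.sub_ne_zero_of_lt hlt
  have hpos' : n ^ 2 - 1 ≠ 0 := Nat.sub_ne_zero_of_lt (hn.trans hlt)
  have hexp : (X - C v : L[X]) ^ (n ^ 2 + 1)
      = (X - C v) ^ (n + 1) * (X - C v) ^ (n ^ 2 - n) := by
    rw [← pow_add, add_right_comm, Nat.add_sub_cancel' hlt.le]
  rw [mul_pow, mul_pow, hexp, mul_assoc _ _ D, mul_assoc _ ((X - C v) ^ (n ^ 2 - n)),
    mul_left_comm N] at h
  have hcancel := congrArg (eval v)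
    (mul_left_cancel₀ (pow_ne_zero (n + 1) (X_sub_C_ne_zero v)) h)
  simpa [zero_pow hpos, zero_pow hpos'] using hcancel

/-- Over a point of the fibre that is rational over `F`, the function `h` has a pole. -/
theorem aeval_denom_eq_zero {Q h : RatFunc F} (hh : quotientMapPGL F = comp h Q) {v t : L}
    (hv : value Q (v : OnePoint L) = (t : OnePoint L)) (hvq : v ^ q = v) :
    aeval t h.denom = 0 := by
  rw [value_eq_coe_iff] at hv
  have hmul := congrArg (Polynomial.map (algebraMap F L))
    (pglNum_mul_homog hh (le_max_left h.num.natDegree h.denom.natDegree) (le_max_right _ _))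
  simp only [Polynomial.map_mul, pglNum, pglDenom, Polynomial.map_pow, Polynomial.map_sub, map_X]
    at hmul
  rw [X_pow_card_sub_X_eq hvq, X_pow_card_sq_sub_X_eq hvq] at hmul
  have h0 := eval_eq_zero_of_mul_pow_eq Fintype.one_lt_card hmul
  rw [eval_map_algebraMap, map_homog (le_max_right _ _) _ hv.2] at h0
  exact (mul_eq_zero.mp h0).resolve_left (pow_ne_zero _ hv.1)

/-- If `w = γ v`, `u = γ w`, `z = γ u`, the cross ratio of these points is determined by `γ`. -/
theorem cross_ratio {a b c d v w u z : L} (hw : a * v + b = w * (c * v + d))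
    (hu : a * w + b = u * (c * w + d)) (hz : a * u + b = z * (c * u + d))
    (hcw : c * w + d ≠ 0) (hcu : c * u + d ≠ 0) :
    (a * d - b * c) * ((z - w) * (u - v)) = (a + d) ^ 2 * ((z - u) * (w - v)) := by
  -- The factors `u - w` from `e2` and `e3` match without being divided out, so the points need not
  -- be distinct.
  have e1 : (u - v) * (c * w + d) = (a + d) * (w - v) := by linear_combination hw - hu
  have e2 : (z - w) * (c * u + d) = (a + d) * (u - w) := by linear_combination hu - hz
  have e3 : (z - u) * ((c * u + d) * (c * w + d)) = (a * d - b * c) * (u - w) := by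
    linear_combination (c * u + d) * hu - (c * w + d) * hz
  apply mul_right_cancel₀ (mul_ne_zero hcw hcu)
  linear_combination (a * d - b * c) * (z - w) * (c * u + d) * e1
    + (a * d - b * c) * (a + d) * (w - v) * e2 - (a + d) ^ 2 * (w - v) * e3

theorem aeval_pglDenom_ne_zero {v : L} (hv : v ^ q ≠ v) : aeval v (pglDenom F) ≠ 0 := by
  simpa [pglDenom, sub_eq_zero] using hv

/-- At a point with `v ^ q = γ(v)`, the quotient map of `PGL(2, F)` takes the value `ι(γ)`. -/
theorem aeval_pglNum {v : L} {γ : PGL(2, F)}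
    (hv : moebius γ (v : OnePoint L) = ((v ^ q : L) : OnePoint L)) :
    aeval v (pglNum F) = algebraMap F L (iota γ) * aeval v (pglDenom F) := by
  -- Frobenius fixes the coefficients of `γ`, so `v, v^q, v^(q²), v^(q³)` are successive images
  -- under `γ`.
  have hw := moebius_algHom (FiniteField.frobeniusAlgHom F L) γ hv
  have hu := moebius_algHom (FiniteField.frobeniusAlgHom F L) γ hw
  obtain ⟨g, rfl⟩ := mk_surjective γ
  simp only [FiniteField.coe_frobeniusAlgHom, moebius_mk_eq_coe_iff] at hv hw hu
  have hdet : algebraMap F L (g 0 0 * g 1 1 - g 0 1 * g 1 0) ≠ 0 := by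
    rw [← Matrix.det_fin_two]
    exact (_root_.map_ne_zero _).mpr g.det_ne_zero
  have hcr := cross_ratio hv.2 hw.2 hu.2 hw.1 hu.1
  have hN : aeval v (pglNum F) = (((v ^ q) ^ q) ^ q - v ^ q) * ((v ^ q) ^ q - v) := by
    simp only [pglNum, map_pow, map_sub, aeval_X]
    rw [pow_succ, sub_pow_card, sq, pow_mul]
  have hD : aeval v (pglDenom F) = (((v ^ q) ^ q) ^ q - (v ^ q) ^ q) * (v ^ q - v) := by
    simp only [pglDenom, map_pow, map_sub, aeval_X]
    rw [pow_succ, sub_pow_card_sq, sq, pow_mul, pow_mul]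
  rw [iota_mk, map_div₀, div_mul_eq_mul_div, eq_div_iff hdet, hN, hD]
  simp only [map_sub, map_mul, map_add, map_pow]
  linear_combination hcr

end FiniteField

end ArtinInvariant

/-! ### The value of `h` at `τ` -/

open ArtinInvariant in
theorem mainTheorem6 {F : Type*} [Field F] [Fintype F]
    (H : Subgroup PGL(2, F)) (QH : RatFunc F) (hQH : ArtinInvariant.IsQuotientMap H QH)
    (h : RatFunc F) (hh : ArtinInvariant.quotientMapPGL F = ArtinInvariant.comp h QH)
    (τ : F)
    (hτ : ArtinInvariant.IsRegular H QH
      ((algebraMap F (AlgebraicClosure F) τ : AlgebraicClosure F) : OnePoint (AlgebraicClosure F)))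
    (γ : H) (hγ : ArtinInvariant.artinInvFrob H QH τ = ConjClasses.mk γ) :
    (γ = 1 → ArtinInvariant.value h (τ : OnePoint F) = (∞ : OnePoint F)) ∧
      (γ ≠ 1 → ArtinInvariant.value h (τ : OnePoint F)
        = ((ArtinInvariant.iota (γ : PGL(2, F)) : F) : OnePoint F)) := by
  have : Finite PGL(2, F) := Finite.of_surjective _ Matrix.ProjGenLinGroup.mk_surjective
  obtain ⟨v, hv⟩ := hτ.exists_value_eq hQH
  obtain ⟨δ, hδ, hδC⟩ := isArtinInv_artinInv hQH hτ
    (σ := FiniteField.frobeniusAlgEquivOfAlgebraic F (AlgebraicClosure F))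
    (AlgEquiv.commutes _ τ) v hv
  rw [FiniteField.coe_frobeniusAlgEquivOfAlgebraic] at hδ
  have hconj : ConjClasses.mk δ = ConjClasses.mk γ := hδC.trans hγ
  rw [ConjClasses.mk_eq_mk_iff_isConj] at hconj
  have hinj := algebraMap F (AlgebraicClosure F) |>.injective
  constructor
  · rintro rfl
    obtain rfl : δ = 1 := isConj_one_left.mp hconj
    apply value_eq_infty
    apply hinj
    rw [map_zero, ← Polynomial.aeval_algebraMap_apply]
    refine aeval_denom_eq_zero hh hv ?_
    rw [Subgroup.coe_one, moebius_one] at hδ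
    exact OnePoint.coe_injective hδ
  · intro hγ1
    have hδ1 : δ ≠ 1 := by
      rintro rfl
      exact hγ1 (isConj_one_right.mp hconj)
    have hvq : v ^ Fintype.card F ≠ v := by
      intro hvq
      apply hδ1
      apply hτ.moebius_injective hQH hv
      simp only [← hδ, hvq, Subgroup.coe_one, moebius_one]
    have hiota : iota (δ : PGL(2, F)) = iota (γ : PGL(2, F)) := by
      obtain ⟨ε, rfl⟩ := isConj_iff.mp hconj
      exact (iota_conj _ _).symm
    have hrel := pglNum_mul_aeval hh hv
    rw [aeval_pglNum hδ.symm, hiota, Polynomial.aeval_algebraMap_apply,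
      Polynomial.aeval_algebraMap_apply] at hrel
    have hnum : Polynomial.aeval τ h.num = iota (γ : PGL(2, F)) * Polynomial.aeval τ h.denom := by
      apply hinj
      rw [map_mul]
      apply mul_right_cancel₀ (aeval_pglDenom_ne_zero hvq)
      linear_combination -hrel
    rw [value_eq_coe_iff]
    -- If the denominator of `h` vanished at `τ`, `hnum` would make the numerator vanish too,
    -- against lowest terms.
    refine ⟨fun h0 => ?_, hnum⟩
    rw [h0, mul_zero] at hnum
    obtain ⟨a, b, hab⟩ := h.isCoprime_num_denom
    have := congrArg (Polynomial.aeval τ) hab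
    rw [map_add, map_mul, map_mul, h0, hnum, mul_zero, mul_zero, add_zero, map_one] at this
    exact zero_ne_one this
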